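/- Consider classical theory: systems are finite non-empty sets $A$ (with real vector space $\mathbb R^A$); states of $A$ are the sub-stochastic vectors $x\ge 0$, $\sum_i x_i\le 1$, deterministic states are the probability vectors; effects are the vectors $a$ with $0\le a_i\le 1$, and $e=(1,\dots,1)$ is the deterministic effect; channels (deterministic transformations) are the column-stochastic matrices; parallel composition is the tensor product. The operational norm is $\|\delta\|=\sup_{a}(2a-e\mid\delta)$, the supremum being over all effects $a$. Preparation tests are finite families of states whose sum is deterministic; a refinement of a state $\rho$ is a subfamily of a preparation test whose sum is $\rho$; a state is pure if all its refinements consist of multiples $\lambda\rho$, $\lambda\in[0,1]$; a dilation of a state $\rho$ of $A$ is a state of a composite $A\times C$ whose marginal on $A$ is $\rho$. Let $p$ be a probability vector on a finite set $A$, and let the bit $B=\{0,1\}$ be the reference system. A compression scheme from $N$ copies of $A$ to $M$ bits is a pair of channels $E$ (from $A^N$ to $B^M$) and $D$ (from $B^M$ to $A^N$). It is $(\varepsilon,N)$-reliable if $$\sup\sum_i\big\|(DE\otimes I_C)\Psi_i-\Psi_i\big\|<\varepsilon ,$$ where the supremum is over all systems $C$ and all refinements $\{\Psi_i\}$ of dilations,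 on $A^N\times C$, of $p^{\otimes N}$. Let $R_{N,\varepsilon}(p)=M_{\min}/N$, where $M_{\min}$ is the least positive integer $M$ for which an $(\varepsilon,N)$-reliable scheme to $M$ bits exists, and let the information content of $p$ be $$I(p)=\lim_{\varepsilon\to0^+}\limsup_{N\to\infty}R_{N,\varepsilon}(p).$$ Then: 1. The limit defining $I(p)$ exists, and $I(p)=H(p)=-\sum_{i\in A}p_i\log_2p_i$, the Shannon entropy of $p$ (with $0\log_2 0=0$). 2. For every compression scheme $(E,D)$, with $T=DE$ and block error probability $$P_{\mathrm e}=\sum_{x\in A^N}\sum_{y\ne x}T_{y,x}\,p^{\otimes N}_x ,$$ for every dilation $\Omega$ of $p^{\otimes N}$ and every finite decomposition $\Omega=\sum_iq_i\Phi_i$, with $q$ a probability vector and the $\Phi_i$ deterministic pure states of $A^N\times C$, one has $$\sum_iq_i\big\|(T\otimes I_C)\Phi_i-\Phi_i\big\|=2P_{\mathrm e}.$$ In particular the supremum of the left-hand side over all such dilations and decompositions equals $2P_{\mathrm e}$. -/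

import Mathlib

open Filter Topology
open scoped Kronecker

noncomputable section

/- Classical theory as an operational probabilistic theory. A system is a finite type `A` (that is,
the space `ℝ^A`); the composite of `A` and `B` is `A × B`, and `N` copies of `A` form the system
`Fin N → A`. -/
namespace ClassicalTheory

variable {A B C ι : Type*} [Fintype A] [Fintype B] [Fintype C] [Fintype ι]

/-- States: sub-stochastic vectors. The deterministic states are the elements of
`stdSimplex ℝ A`, the probability vectors. -/
def IsState (x : A → ℝ) : Prop := (∀ i, 0 ≤ x i) ∧ ∑ i, x i ≤ 1

/-- Effects: positive vectors dominated by the all-ones vector. -/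
def IsEffect (a : A → ℝ) : Prop := ∀ i, 0 ≤ a i ∧ a i ≤ 1

/-- The (unique) deterministic effect of the system `A`. -/
def detEffect (A : Type*) : A → ℝ := fun _ => 1

/-- Deterministic transformations: matrices all of whose columns are probability vectors. -/
def IsChannel (T : Matrix B A ℝ) : Prop := ∀ j, (fun i => T i j) ∈ stdSimplex ℝ B

/-- Preparation tests: finite families of states whose coarse-graining is deterministic. -/
def IsPreparationTest (Ψ : ι → A → ℝ) : Prop :=
  (∀ i, IsState (Ψ i)) ∧ ∑ i, Ψ i ∈ stdSimplex ℝ A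

/-- `Ψ` refines `ρ`: it is part of a preparation test and its coarse-graining is `ρ`. -/
def IsRefinement (Ψ : ι → A → ℝ) (ρ : A → ℝ) : Prop :=
  (∃ (m : ℕ) (Φ : Fin m → A → ℝ), IsPreparationTest (Sum.elim Ψ Φ)) ∧ ∑ i, Ψ i = ρ

/-- Pure states: states all of whose refinements are trivial. -/
def IsPure (ρ : A → ℝ) : Prop :=
  IsState ρ ∧ ∀ (n : ℕ) (Ψ : Fin n → A → ℝ), IsRefinement Ψ ρ →
    ∀ i, ∃ t ∈ Set.Icc (0 : ℝ) 1, Ψ i = t • ρ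

/-- `q, Φ` is a decomposition of `ρ` as a convex combination of deterministic pure states. -/
def IsPureDecomposition (q : ι → ℝ) (Φ : ι → A → ℝ) (ρ : A → ℝ) : Prop :=
  q ∈ stdSimplex ℝ ι ∧ (∀ i, Φ i ∈ stdSimplex ℝ A ∧ IsPure (Φ i)) ∧ ∑ i, q i • Φ i = ρ

/-- `Ω`, a state of the composite of `A` and `C`, is a dilation of `ρ`: applying the deterministic
effect to `C` gives `ρ`. -/
def IsDilation (Ω : A × C → ℝ) (ρ : A → ℝ) : Prop :=
  IsState Ω ∧ ∀ i, ∑ j, detEffect C j * Ω (i, j) = ρ i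

/-- Operational norm: the supremum of `(2a - e | δ)` over all effects `a`. -/
def opNorm (δ : A → ℝ) : ℝ :=
  ⨆ a : {a : A → ℝ // IsEffect a}, (2 • a.1 - detEffect A) ⬝ᵥ δ

/-- The state `p ⊠ ⋯ ⊠ p` of `N` copies of the system. -/
def tensorPow (p : A → ℝ) (N : ℕ) : (Fin N → A) → ℝ := fun x => ∏ k, p (x k)

/-- Compression schemes from `N` copies of `A` to `M` copies of `B`: an encoding channel and a
decoding channel. -/
structure CompressionScheme (A B : Type*) [Fintype A] [Fintype B] (N M : ℕ) where
  enc : Matrix (Fin M → B) (Fin N → A) ℝ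
  dec : Matrix (Fin N → A) (Fin M → B) ℝ
  enc_isChannel : IsChannel enc
  dec_isChannel : IsChannel dec

/-- Encoding followed by decoding. -/
def CompressionScheme.total {N M : ℕ} (S : CompressionScheme A B N M) :
    Matrix (Fin N → A) (Fin N → A) ℝ := S.dec * S.enc

/-- The norm `‖(T ⊠ I) Ψ - Ψ‖`, where `T` acts on `A` and the ancillary system is `C`. -/
def disturbance [DecidableEq C] (T : Matrix A A ℝ) (Ψ : A × C → ℝ) : ℝ :=
  opNorm ((T ⊗ₖ (1 : Matrix C C ℝ)).mulVec Ψ - Ψ)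

/-- Figure of merit of a scheme: the supremum of `∑ i, ‖(DE ⊠ I) Ψ i - Ψ i‖` over all ancillary
systems and all refinements `Ψ` of all dilations of the `N`-copy state. -/
def figureOfMerit {N M : ℕ} (p : A → ℝ) (S : CompressionScheme A B N M) : EReal :=
  ⨆ (c : ℕ) (Ω : (Fin N → A) × Fin c → ℝ) (_ : IsDilation Ω (tensorPow p N))
    (n : ℕ) (Ψ : Fin n → (Fin N → A) × Fin c → ℝ) (_ : IsRefinement Ψ Ω),
    ((∑ i, disturbance S.total (Ψ i) : ℝ) : EReal)

/-- The same with decompositions into deterministic pure states only: the supremum of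
`∑ i, q i * ‖(DE ⊠ I) Φ i - Φ i‖`. -/
def pureFigureOfMerit {N M : ℕ} (p : A → ℝ) (S : CompressionScheme A B N M) : EReal :=
  ⨆ (c : ℕ) (Ω : (Fin N → A) × Fin c → ℝ) (_ : IsDilation Ω (tensorPow p N))
    (n : ℕ) (q : Fin n → ℝ) (Φ : Fin n → (Fin N → A) × Fin c → ℝ)
    (_ : IsPureDecomposition q Φ Ω),
    ((∑ i, q i * disturbance S.total (Φ i) : ℝ) : EReal)

/-- Block error probability: the probability that the decoded string differs from the string
emitted by the source. -/
def errorProbability [DecidableEq A] {N M : ℕ} (p : A → ℝ) (S : CompressionScheme A B N M) : ℝ :=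
  ∑ x, ∑ y with y ≠ x, S.total y x * tensorPow p N x

/-- The `(ε, N)`-reliable compression schemes for `p` using `M` copies of the obit `B`. -/
def reliableSchemes (B : Type*) [Fintype B] (p : A → ℝ) (N M : ℕ) (ε : ℝ) :
    Set (CompressionScheme A B N M) :=
  {S | figureOfMerit p S < (ε : EReal)}

/-- Smallest achievable compression ratio: the least `M / N`, with `M` a positive integer, such that
an `(ε, N)`-reliable scheme exists (and `⊤` if there is no such `M`). -/
def compressionRatio (B : Type*) [Fintype B] (p : A → ℝ) (ε : ℝ) (N : ℕ) : EReal :=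
  ⨅ (M : ℕ) (_ : 0 < M ∧ (reliableSchemes B p N M ε).Nonempty), (((M : ℝ) / (N : ℝ) : ℝ) : EReal)

/-- The asymptotic compression ratio at tolerance `ε`: the `limsup` over the number of copies. -/
def asymptoticRatio (B : Type*) [Fintype B] (p : A → ℝ) (ε : ℝ) : EReal :=
  limsup (compressionRatio B p ε) atTop

/-- Information content of `p` with respect to the obit `B`: the limit of the asymptotic
compression ratio as the tolerance tends to `0` from the right. -/
def informationContent (B : Type*) [Fintype B] (p : A → ℝ) : EReal :=
  limUnder (𝓝[>] (0 : ℝ)) (asymptoticRatio B p)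

/-- Shannon entropy in bits (with `0 log 0 = 0`). -/
def shannonEntropy (p : A → ℝ) : ℝ := -∑ i, p i * Real.logb 2 (p i)

end ClassicalTheory

end

open ClassicalTheory

open ClassicalTheory

namespace ClassicalTheory

open Finset

/-! ### The operational norm as an ℓ¹ norm, and the disturbance caused by a channel. -/

section OperationalNorm

variable {A B C ι : Type*} [Fintype A] [Fintype B] [Fintype C] [Fintype ι]

/-! The operational norm is the ℓ¹ norm, and column `x` of `T - 1` has ℓ¹ norm twice the probability
that `T` changes `x`, with or without an ancilla. Pure deterministic states are point masses, so a
pure decomposition of a dilation averages these norms against the source: exactly `2 P_e`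
(`sum_mul_disturbance_eq`). For arbitrary refinements the triangle inequality gives at most `2 P_e`,
which is attained, so reliability just means `2 P_e < ε` (`figureOfMerit_eq`).

What remains is Shannon's source coding theorem. A Chernoff bound makes strings whose probability is
exponentially far from `2 ^ (-N H)` negligible (`tendsto_blockProb_zero`). Encoding only the strings
that are not too improbable achieves every rate above `H`; below `H`, a trace bound on `DE` forces
the success probability to zero (`one_sub_errorProbability_le`). The ratio thus tends to `H` for
every `ε` in `(0, 2)`, and the limit in `ε` is that of an eventually constant function. -/

lemma opNorm_eq_sum_abs (δ : A → ℝ) : opNorm δ = ∑ i, |δ i| := by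
  classical
  have hle : ∀ a : {a : A → ℝ // IsEffect a},
      (2 • a.1 - detEffect A) ⬝ᵥ δ ≤ ∑ i, |δ i| := by
    intro a
    refine sum_le_sum fun i _ => ?_
    have h := a.2 i
    have h1 : |(2 • a.1 - detEffect A) i| ≤ 1 := by
      simp only [two_smul, Pi.sub_apply, Pi.add_apply, detEffect]
      rw [abs_le]
      constructor <;> linarith [h.1, h.2]
    calc (2 • a.1 - detEffect A) i * δ i ≤ |(2 • a.1 - detEffect A) i * δ i| := le_abs_self _
      _ = |(2 • a.1 - detEffect A) i| * |δ i| := abs_mul _ _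
      _ ≤ 1 * |δ i| := by gcongr
      _ = |δ i| := one_mul _
  -- The optimal effect tests for the coordinates where `δ` is nonnegative.
  let s : {a : A → ℝ // IsEffect a} :=
    ⟨fun i => if 0 ≤ δ i then 1 else 0, fun i => by dsimp only; split_ifs <;> norm_num⟩
  have : Nonempty {a : A → ℝ // IsEffect a} := ⟨s⟩
  refine le_antisymm (ciSup_le hle) ?_
  have hs : (2 • s.1 - detEffect A) ⬝ᵥ δ = ∑ i, |δ i| := by
    refine sum_congr rfl fun i _ => ?_
    simp only [s, two_smul, Pi.sub_apply, Pi.add_apply, detEffect]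
    split_ifs with h
    · rw [abs_of_nonneg h]; ring
    · rw [abs_of_neg (not_le.1 h)]; ring
  rw [← hs]
  exact le_ciSup (f := fun a : {a : A → ℝ // IsEffect a} => (2 • a.1 - detEffect A) ⬝ᵥ δ)
    ⟨_, by rintro _ ⟨a, rfl⟩; exact hle a⟩ s

lemma IsChannel.mul {X : Type*} {T : Matrix B X ℝ} {U : Matrix C B ℝ} (hU : IsChannel U)
    (hT : IsChannel T) : IsChannel (U * T) := by
  intro j
  refine ⟨fun i => sum_nonneg fun k _ => mul_nonneg ((hU k).1 i) ((hT j).1 k), ?_⟩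
  simp only [Matrix.mul_apply]
  rw [sum_comm]
  simp only [← sum_mul]
  rw [← (hT j).2]
  exact sum_congr rfl fun k _ => by rw [(hU k).2, one_mul]

lemma CompressionScheme.total_isChannel {N M : ℕ} (S : CompressionScheme A B N M) :
    IsChannel S.total := S.dec_isChannel.mul S.enc_isChannel

/-- The probability that the transformation `T` changes the letter `x`. -/
noncomputable def letterError [DecidableEq A] (T : Matrix A A ℝ) (x : A) : ℝ :=
  ∑ y with y ≠ x, T y x

lemma letterError_add_diag [DecidableEq A] {T : Matrix A A ℝ} (hT : IsChannel T) (x : A) :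
    letterError T x + T x x = 1 := by
  rw [← (hT x).2, letterError, filter_ne', sum_erase_eq_sub (mem_univ x)]
  ring

/-- Columns sum to one, so the diagonal defect `1 - T x x` equals the total off-diagonal mass, and
each contributes one `letterError`. -/
lemma sum_abs_kronecker_one_sub_one [DecidableEq A] [DecidableEq C] {T : Matrix A A ℝ}
    (hT : IsChannel T) (z : A × C) :
    ∑ w, |(T ⊗ₖ (1 : Matrix C C ℝ)) w z - (1 : Matrix (A × C) (A × C) ℝ) w z| =
      2 * letterError T z.1 := by
  obtain ⟨x, c⟩ := z
  have h1 : ∀ y : A, ∑ d : C, |(T ⊗ₖ (1 : Matrix C C ℝ)) (y, d) (x, c) -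
      (1 : Matrix (A × C) (A × C) ℝ) (y, d) (x, c)| = |T y x - if y = x then 1 else 0| := by
    intro y
    rw [sum_eq_single c]
    · simp [Matrix.kroneckerMap_apply, Matrix.one_apply]
    · intro d _ hd
      simp [Matrix.kroneckerMap_apply, hd]
    · simp
  have h2 := letterError_add_diag hT x
  rw [Fintype.sum_prod_type]
  simp only [h1]
  rw [← add_sum_erase _ _ (mem_univ x), ← filter_ne']
  have h3 : ∑ y with y ≠ x, |T y x - if y = x then 1 else 0| = letterError T x := by
    refine sum_congr rfl fun y hy => ?_
    rw [if_neg (mem_filter.1 hy).2, sub_zero, abs_of_nonneg ((hT x).1 y)]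
  have h4 : 0 ≤ letterError T x := sum_nonneg fun y _ => (hT x).1 y
  rw [h3, if_pos rfl, abs_of_nonpos (by linarith)]
  linarith

lemma disturbance_eq_sum_abs [DecidableEq A] [DecidableEq C] (T : Matrix A A ℝ)
    (Ψ : A × C → ℝ) :
    disturbance T Ψ = ∑ w, |∑ z, ((T ⊗ₖ (1 : Matrix C C ℝ)) w z -
      (1 : Matrix (A × C) (A × C) ℝ) w z) * Ψ z| := by
  rw [disturbance, opNorm_eq_sum_abs]
  refine sum_congr rfl fun w _ => ?_
  conv_lhs => rw [← Matrix.one_mulVec Ψ, Matrix.mulVec_mulVec, Matrix.mul_one, ← Matrix.sub_mulVec]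
  rfl

lemma disturbance_le [DecidableEq A] [DecidableEq C] {T : Matrix A A ℝ} (hT : IsChannel T)
    {Ψ : A × C → ℝ} (hΨ : ∀ z, 0 ≤ Ψ z) :
    disturbance T Ψ ≤ ∑ z, Ψ z * (2 * letterError T z.1) := by
  rw [disturbance_eq_sum_abs]
  calc _ ≤ ∑ w, ∑ z, Ψ z * |(T ⊗ₖ (1 : Matrix C C ℝ)) w z -
        (1 : Matrix (A × C) (A × C) ℝ) w z| := by
        refine sum_le_sum fun w _ => (abs_sum_le_sum_abs _ _).trans_eq ?_
        exact sum_congr rfl fun z _ => by rw [abs_mul, abs_of_nonneg (hΨ z), mul_comm]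
    _ = _ := by
        rw [sum_comm]
        refine sum_congr rfl fun z _ => ?_
        rw [← mul_sum, sum_abs_kronecker_one_sub_one hT]

/-- A point mass selects a single column, so no cancellation occurs and the bound of
`disturbance_le` is attained. -/
lemma disturbance_single [DecidableEq A] [DecidableEq C] {T : Matrix A A ℝ} (hT : IsChannel T)
    (z : A × C) {t : ℝ} (ht : 0 ≤ t) :
    disturbance T (Pi.single z t) = t * (2 * letterError T z.1) := by
  rw [disturbance_eq_sum_abs, ← sum_abs_kronecker_one_sub_one hT, mul_sum]
  refine sum_congr rfl fun w _ => ?_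
  rw [sum_eq_single z (fun v _ hv => by simp [hv]) (by simp), Pi.single_eq_same, abs_mul,
    abs_of_nonneg ht, mul_comm]

end OperationalNorm

/-! ### Pure states, dilations, and the figures of merit as twice the block error. -/

section FigureOfMerit

variable {A B C ι : Type*} [Fintype A] [Fintype B] [Fintype C] [Fintype ι]

lemma IsState.of_nonneg_of_le {x y : A → ℝ} (hy : IsState y) (hx : ∀ i, 0 ≤ x i)
    (hxy : ∀ i, x i ≤ y i) : IsState x :=
  ⟨hx, (sum_le_sum fun i _ => hxy i).trans hy.2⟩

lemma isState_of_mem_stdSimplex {x : A → ℝ} (hx : x ∈ stdSimplex ℝ A) : IsState x :=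
  ⟨hx.1, hx.2.le⟩

lemma isRefinement_of_nonneg {Ψ : ι → A → ℝ} {ρ : A → ℝ} (hρ : ρ ∈ stdSimplex ℝ A)
    (hΨ : ∀ i x, 0 ≤ Ψ i x) (hsum : ∑ i, Ψ i = ρ) : IsRefinement Ψ ρ := by
  refine ⟨⟨0, Fin.elim0, ?_, ?_⟩, hsum⟩
  · rintro (i | i)
    · refine (isState_of_mem_stdSimplex hρ).of_nonneg_of_le (hΨ i) fun x => ?_
      rw [← hsum, Finset.sum_apply]
      exact single_le_sum (f := fun i => Ψ i x) (fun j _ => hΨ j x) (mem_univ i)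
    · exact i.elim0
  · rw [Fintype.sum_sum_type]
    simpa [hsum] using hρ

lemma IsPure.eq_single [DecidableEq A] {Φ : A → ℝ} (hΦ : Φ ∈ stdSimplex ℝ A) (h : IsPure Φ) :
    ∃ x, Φ = Pi.single x 1 := by
  obtain ⟨x, hx⟩ : ∃ x, Φ x ≠ 0 := by
    by_contra! hcon
    have := hΦ.2
    simp [hcon] at this
  -- Splitting off the mass at one point of the support must be a trivial refinement, so `Φ` lives
  -- at that point.
  have hr : IsRefinement ![Pi.single x (Φ x), Φ - Pi.single x (Φ x)] Φ := by
    refine isRefinement_of_nonneg hΦ ?_ (by simp)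
    intro i y
    have := hΦ.1 y
    fin_cases i <;> by_cases hy : y = x
    · subst hy; simpa using this
    · simp [hy]
    · subst hy; simp
    · simpa [hy] using this
  obtain ⟨t, -, ht⟩ := h.2 2 _ hr 0
  have ht' : (Pi.single x (Φ x) : A → ℝ) = t • Φ := ht
  have h1 := congrFun ht' x
  rw [Pi.single_eq_same, Pi.smul_apply, smul_eq_mul] at h1
  have ht1 : t = 1 := by
    have : (1 - t) * Φ x = 0 := by linarith
    rcases mul_eq_zero.1 this with h | h
    · linarith
    · exact absurd h hx
  rw [ht1, one_smul] at ht'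
  have h2 := hΦ.2
  rw [← ht', sum_pi_single'] at h2
  simp only [mem_univ, if_true] at h2
  exact ⟨x, by rw [← ht', h2]⟩

lemma isPure_single [DecidableEq A] (x : A) : IsPure (Pi.single x 1 : A → ℝ) := by
  refine ⟨isState_of_mem_stdSimplex (single_mem_stdSimplex ℝ x), ?_⟩
  rintro n Ψ ⟨⟨m, Φ, hΦ, -⟩, hsum⟩ i
  have hpos : ∀ j y, 0 ≤ Ψ j y := fun j y => (hΦ (Sum.inl j)).1 y
  have hle : ∀ y, Ψ i y ≤ (Pi.single x 1 : A → ℝ) y := by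
    intro y
    rw [← hsum, Finset.sum_apply]
    exact single_le_sum (f := fun i => Ψ i y) (fun j _ => hpos j y) (mem_univ i)
  refine ⟨Ψ i x, ⟨hpos i x, by simpa using hle x⟩, ?_⟩
  ext y
  by_cases hy : y = x
  · subst hy; simp
  · have := hle y
    simp only [Pi.smul_apply, smul_eq_mul, Pi.single_eq_of_ne hy, mul_zero] at this ⊢
    exact le_antisymm this (hpos i y)

lemma tensorPow_mem_stdSimplex {p : A → ℝ} (hp : p ∈ stdSimplex ℝ A) (N : ℕ) :
    tensorPow p N ∈ stdSimplex ℝ (Fin N → A) := by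
  classical
  refine ⟨fun x => prod_nonneg fun k _ => hp.1 _, ?_⟩
  simp only [tensorPow]
  rw [← Fintype.prod_sum, prod_const, hp.2, one_pow]

lemma IsDilation.sum_mul_fst {Ω : A × C → ℝ} {ρ : A → ℝ} (h : IsDilation Ω ρ) (g : A → ℝ) :
    ∑ z, Ω z * g z.1 = ∑ x, ρ x * g x := by
  rw [Fintype.sum_prod_type]
  refine sum_congr rfl fun x _ => ?_
  rw [← h.2 x, sum_mul]
  simp [detEffect]

lemma errorProbability_eq [DecidableEq A] {N M : ℕ} (p : A → ℝ) (S : CompressionScheme A B N M) :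
    errorProbability p S = ∑ x, tensorPow p N x * letterError S.total x := by
  refine sum_congr rfl fun x _ => ?_
  rw [letterError, mul_sum]
  exact sum_congr rfl fun y _ => mul_comm _ _

lemma sum_tensorPow_mul_two_letterError [DecidableEq A] {N M : ℕ} (p : A → ℝ)
    (S : CompressionScheme A B N M) :
    ∑ x, tensorPow p N x * (2 * letterError S.total x) = 2 * errorProbability p S := by
  rw [errorProbability_eq, mul_sum]
  exact sum_congr rfl fun x _ => by ring

lemma sum_mul_disturbance_eq [DecidableEq A] {N M : ℕ} {p : A → ℝ}
    (S : CompressionScheme A B N M) [DecidableEq C] {Ω : (Fin N → A) × C → ℝ}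
    (hΩ : IsDilation Ω (tensorPow p N)) {q : ι → ℝ} {Φ : ι → (Fin N → A) × C → ℝ}
    (h : IsPureDecomposition q Φ Ω) :
    ∑ i, q i * disturbance S.total (Φ i) = 2 * errorProbability p S := by
  rw [← sum_tensorPow_mul_two_letterError,
    ← hΩ.sum_mul_fst (fun x => 2 * letterError S.total x), ← h.2.2]
  simp only [Finset.sum_apply, Pi.smul_apply, smul_eq_mul, sum_mul]
  rw [sum_comm]
  refine sum_congr rfl fun i _ => ?_
  obtain ⟨z, hz⟩ := (h.2.1 i).2.eq_single (h.2.1 i).1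
  rw [hz, disturbance_single S.total_isChannel z zero_le_one,
    sum_eq_single z (fun v _ hv => by simp [hv]) (by simp)]
  simp

lemma sum_disturbance_le [DecidableEq A] {N M : ℕ} {p : A → ℝ}
    (S : CompressionScheme A B N M) [DecidableEq C] {Ω : (Fin N → A) × C → ℝ}
    (hΩ : IsDilation Ω (tensorPow p N)) {Ψ : ι → (Fin N → A) × C → ℝ}
    (h : IsRefinement Ψ Ω) :
    ∑ i, disturbance S.total (Ψ i) ≤ 2 * errorProbability p S := by
  obtain ⟨⟨m, Φ, hΦ, -⟩, hsum⟩ := h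
  rw [← sum_tensorPow_mul_two_letterError,
    ← hΩ.sum_mul_fst (fun x => 2 * letterError S.total x), ← hsum]
  simp only [Finset.sum_apply, sum_mul]
  rw [sum_comm]
  exact sum_le_sum fun i _ => disturbance_le S.total_isChannel (hΦ (Sum.inl i)).1

/-- A state regarded as a state of the composite with the trivial system. -/
def trivialDilation (ρ : A → ℝ) : A × Fin 1 → ℝ := fun z => ρ z.1

lemma trivialDilation_mem_stdSimplex {ρ : A → ℝ} (hρ : ρ ∈ stdSimplex ℝ A) :
    trivialDilation ρ ∈ stdSimplex ℝ (A × Fin 1) :=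
  ⟨fun z => hρ.1 z.1, by rw [Fintype.sum_prod_type]; simpa [trivialDilation] using hρ.2⟩

lemma isDilation_trivialDilation {ρ : A → ℝ} (hρ : ρ ∈ stdSimplex ℝ A) :
    IsDilation (trivialDilation ρ) ρ :=
  ⟨isState_of_mem_stdSimplex (trivialDilation_mem_stdSimplex hρ), fun i => by
    simp [detEffect, trivialDilation]⟩

lemma isPureDecomposition_single [DecidableEq A] {ρ : A → ℝ} (hρ : ρ ∈ stdSimplex ℝ A)
    (e : ι ≃ A) : IsPureDecomposition (fun i => ρ (e i)) (fun i => Pi.single (e i) 1) ρ := by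
  refine ⟨⟨fun i => hρ.1 _, ?_⟩,
    fun i => ⟨single_mem_stdSimplex ℝ _, isPure_single _⟩, ?_⟩
  · rw [e.sum_comp]; exact hρ.2
  · rw [e.sum_comp (fun x => ρ x • (Pi.single x 1 : A → ℝ))]
    ext y
    simp [Finset.sum_apply, Pi.single_apply]

lemma pureFigureOfMerit_eq [DecidableEq A] {N M : ℕ} {p : A → ℝ} (hp : p ∈ stdSimplex ℝ A)
    (S : CompressionScheme A B N M) :
    pureFigureOfMerit p S = ((2 * errorProbability p S : ℝ) : EReal) := by
  have hρ := tensorPow_mem_stdSimplex hp N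
  apply le_antisymm
  · exact iSup_le fun c => iSup_le fun Ω => iSup_le fun hΩ => iSup_le fun n => iSup_le fun q =>
      iSup_le fun Φ => iSup_le fun h => by rw [sum_mul_disturbance_eq S hΩ h]
  · have h := isPureDecomposition_single (trivialDilation_mem_stdSimplex hρ)
      (Fintype.equivFin ((Fin N → A) × Fin 1)).symm
    rw [← sum_mul_disturbance_eq S (isDilation_trivialDilation hρ) h]
    exact le_iSup_of_le _ <| le_iSup_of_le _ <| le_iSup_of_le (isDilation_trivialDilation hρ) <|
      le_iSup_of_le _ <| le_iSup_of_le _ <| le_iSup_of_le _ <| le_iSup_of_le h le_rfl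

/-- The supremum is attained without any real ancilla: refine the trivial dilation into its atoms.
-/
lemma figureOfMerit_eq [DecidableEq A] {N M : ℕ} {p : A → ℝ} (hp : p ∈ stdSimplex ℝ A)
    (S : CompressionScheme A B N M) :
    figureOfMerit p S = ((2 * errorProbability p S : ℝ) : EReal) := by
  have hρ := tensorPow_mem_stdSimplex hp N
  apply le_antisymm
  · exact iSup_le fun c => iSup_le fun Ω => iSup_le fun hΩ => iSup_le fun n => iSup_le fun Ψ =>
      iSup_le fun h => EReal.coe_le_coe_iff.2 (sum_disturbance_le S hΩ h)
  · have hτ := trivialDilation_mem_stdSimplex hρ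
    let e := (Fintype.equivFin ((Fin N → A) × Fin 1)).symm
    have h := isPureDecomposition_single hτ e
    have hr : IsRefinement
        (fun i => Pi.single (e i) (trivialDilation (tensorPow p N) (e i)))
        (trivialDilation (tensorPow p N)) := by
      refine isRefinement_of_nonneg hτ (fun i z => ?_) ?_
      · rw [Pi.single_apply]
        split_ifs
        exacts [hτ.1 _, le_rfl]
      · conv_rhs => rw [← h.2.2]
        refine sum_congr rfl fun i _ => ?_
        rw [← Pi.single_smul]
        simp
    rw [← sum_mul_disturbance_eq S (isDilation_trivialDilation hρ) h]
    refine le_iSup_of_le _ <| le_iSup_of_le _ <| le_iSup_of_le (isDilation_trivialDilation hρ) <|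
      le_iSup_of_le _ <| le_iSup_of_le _ <| le_iSup_of_le hr ?_
    refine EReal.coe_le_coe_iff.2 (sum_le_sum fun i _ => ?_)
    rw [disturbance_single S.total_isChannel _ (hτ.1 _),
      disturbance_single S.total_isChannel _ zero_le_one, one_mul]

end FigureOfMerit

/-! ### Shannon's source coding theorem. -/

section SourceCoding

variable {A : Type*} [Fintype A]

/-- Probability of an event for `N` independent letters with distribution `p`. -/
noncomputable def blockProb (p : A → ℝ) (N : ℕ) (s : Set (Fin N → A)) : ℝ :=
  ∑ x, s.indicator (tensorPow p N) x

/-- The moment generating function equals one at `0` and its derivative there is the negative mean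
of `v`. -/
lemma exists_sum_mul_exp_lt_one {p : A → ℝ} (hp : p ∈ stdSimplex ℝ A) {v : A → ℝ}
    (hv : ∑ i, p i * v i < 0) : ∃ t > 0, ∑ i, p i * Real.exp (t * v i) < 1 := by
  have hd : HasDerivAt (fun t : ℝ => ∑ i, p i * Real.exp (t * v i)) (∑ i, p i * v i) 0 := by
    refine HasDerivAt.fun_sum fun i _ => ?_
    have h := (((hasDerivAt_id (0 : ℝ)).mul_const (v i)).exp).const_mul (p i)
    simpa using h
  have hev := (hasDerivWithinAt_iff_tendsto_slope' (Set.self_notMem_Ioi)).1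
    (hd.hasDerivWithinAt (s := Set.Ioi 0)) |>.eventually_lt_const hv
  obtain ⟨t, ht, ht0⟩ := (hev.and self_mem_nhdsWithin).exists
  refine ⟨t, ht0, ?_⟩
  have ht0' : (0 : ℝ) < t := ht0
  rw [slope_def_field, sub_zero, div_neg_iff] at ht
  simp only [zero_mul, Real.exp_zero, mul_one, hp.2] at ht
  rcases ht with h | h <;> linarith [h.1, h.2]

/-- Chernoff bound: the indicator is dominated by `exp (t * ∑ k, v (x k))`, whose expectation
factors into an `N`-th power. -/
lemma tendsto_blockProb_zero {p : A → ℝ} (hp : p ∈ stdSimplex ℝ A) {v : A → ℝ}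
    (hv : ∑ i, p i * v i < 0) :
    Tendsto (fun N => blockProb p N {x | 0 ≤ ∑ k, v (x k)}) atTop (𝓝 0) := by
  classical
  obtain ⟨t, ht0, ht⟩ := exists_sum_mul_exp_lt_one hp hv
  have h0 : 0 ≤ ∑ i, p i * Real.exp (t * v i) :=
    sum_nonneg fun i _ => mul_nonneg (hp.1 i) (Real.exp_pos _).le
  refine squeeze_zero (fun N => ?_) (fun N => ?_) (tendsto_pow_atTop_nhds_zero_of_lt_one h0 ht)
  · exact sum_nonneg fun x _ => Set.indicator_nonneg
      (fun x _ => (tensorPow_mem_stdSimplex hp N).1 x) x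
  · have hpow : (∑ i, p i * Real.exp (t * v i)) ^ N =
        ∑ x : Fin N → A, tensorPow p N x * Real.exp (t * ∑ k, v (x k)) := by
      have h := Fintype.prod_sum (fun (_ : Fin N) i => p i * Real.exp (t * v i))
      rw [prod_const, card_univ, Fintype.card_fin] at h
      rw [h]
      refine sum_congr rfl fun x _ => ?_
      rw [prod_mul_distrib, mul_sum, Real.exp_sum, tensorPow]
    rw [hpow]
    refine sum_le_sum fun x _ => ?_
    have hx := (tensorPow_mem_stdSimplex hp N).1 x
    by_cases hv' : 0 ≤ ∑ k, v (x k)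
    · rw [Set.indicator_of_mem (by exact hv')]
      exact le_mul_of_one_le_right hx (Real.one_le_exp (mul_nonneg ht0.le hv'))
    · rw [Set.indicator_of_notMem (by exact hv')]
      exact mul_nonneg hx (Real.exp_pos _).le

/-- Null strings are exempt because `Real.logb 2 0 = 0` breaks the log-likelihood identity
`logb_tensorPow` on them. -/
lemma blockProb_mono {p : A → ℝ} (hp : p ∈ stdSimplex ℝ A) {N : ℕ} {s t : Set (Fin N → A)}
    (h : ∀ x ∈ s, tensorPow p N x ≠ 0 → x ∈ t) : blockProb p N s ≤ blockProb p N t := by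
  refine sum_le_sum fun x _ => ?_
  have h0 := (tensorPow_mem_stdSimplex hp N).1
  by_cases hs : x ∈ s
  · by_cases hx : tensorPow p N x = 0
    · rw [Set.indicator_of_mem hs, hx]
      exact Set.indicator_nonneg (fun x _ => h0 x) x
    · rw [Set.indicator_of_mem hs, Set.indicator_of_mem (h x hs hx)]
  · rw [Set.indicator_of_notMem hs]
    exact Set.indicator_nonneg (fun x _ => h0 x) x

lemma blockProb_nonneg {p : A → ℝ} (hp : p ∈ stdSimplex ℝ A) {N : ℕ} (s : Set (Fin N → A)) :
    0 ≤ blockProb p N s :=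
  sum_nonneg fun x _ => Set.indicator_nonneg (fun x _ => (tensorPow_mem_stdSimplex hp N).1 x) x

lemma logb_tensorPow {X : Type*} {p : X → ℝ} {N : ℕ} {x : Fin N → X} (hx : tensorPow p N x ≠ 0) :
    Real.logb 2 (tensorPow p N x) = ∑ k, Real.logb 2 (p (x k)) := by
  rw [tensorPow, Real.logb_prod]
  exact fun k hk => prod_ne_zero_iff.1 hx k hk

lemma tendsto_blockProb_atypically_small {p : A → ℝ} (hp : p ∈ stdSimplex ℝ A) {r : ℝ}
    (hr : shannonEntropy p < r) :
    Tendsto (fun N : ℕ => blockProb p N {x | tensorPow p N x < (2 : ℝ) ^ (-(N * r))}) atTop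
      (𝓝 0) := by
  have hv : ∑ i, p i * (-Real.logb 2 (p i) - r) < 0 := by
    simp only [mul_sub, sum_sub_distrib, ← sum_mul, hp.2, mul_neg, sum_neg_distrib]
    rw [shannonEntropy] at hr
    linarith
  refine squeeze_zero (fun N => blockProb_nonneg hp _) (fun N => blockProb_mono hp ?_)
    (tendsto_blockProb_zero hp hv)
  intro x hx h0
  have hpos := ((tensorPow_mem_stdSimplex hp N).1 x).lt_of_ne' h0
  have h := Real.logb_lt_logb (one_lt_two) hpos hx
  rw [Real.logb_rpow two_pos (by norm_num), logb_tensorPow h0] at h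
  simp only [Set.mem_ofPred_eq, sum_sub_distrib, sum_neg_distrib, sum_const, card_univ,
    Fintype.card_fin, nsmul_eq_mul]
  linarith

lemma tendsto_blockProb_atypically_large {p : A → ℝ} (hp : p ∈ stdSimplex ℝ A) {r : ℝ}
    (hr : r < shannonEntropy p) :
    Tendsto (fun N : ℕ => blockProb p N {x | (2 : ℝ) ^ (-(N * r)) < tensorPow p N x}) atTop
      (𝓝 0) := by
  have hv : ∑ i, p i * (Real.logb 2 (p i) + r) < 0 := by
    simp only [mul_add, sum_add_distrib, ← sum_mul, hp.2]
    rw [shannonEntropy] at hr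
    linarith
  refine squeeze_zero (fun N => blockProb_nonneg hp _) (fun N => blockProb_mono hp ?_)
    (tendsto_blockProb_zero hp hv)
  intro x hx h0
  have h := Real.logb_lt_logb (one_lt_two) (Real.rpow_pos_of_pos two_pos _) hx
  rw [Real.logb_rpow two_pos (by norm_num), logb_tensorPow h0] at h
  simp only [Set.mem_ofPred_eq, sum_add_distrib, sum_const, card_univ,
    Fintype.card_fin, nsmul_eq_mul]
  linarith

/-- The channel induced by a function. -/
def funChannel {X Y : Type*} [DecidableEq Y] (f : X → Y) : Matrix Y X ℝ :=
  fun y x => if y = f x then 1 else 0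

lemma funChannel_isChannel {X Y : Type*} [Fintype Y] [DecidableEq Y] (f : X → Y) :
    IsChannel (funChannel f) := by
  refine fun x => ⟨fun y => ?_, ?_⟩
  · simp only [funChannel]
    split_ifs <;> norm_num
  · simp [funChannel]

/-- The compression scheme with deterministic encoding `f` and decoding `g`. -/
def funScheme {B : Type*} [Fintype B] [DecidableEq A] [DecidableEq B] {N M : ℕ}
    (f : (Fin N → A) → (Fin M → B)) (g : (Fin M → B) → (Fin N → A)) :
    CompressionScheme A B N M where
  enc := funChannel f
  dec := funChannel g
  enc_isChannel := funChannel_isChannel f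
  dec_isChannel := funChannel_isChannel g

lemma letterError_funScheme {B : Type*} [Fintype B] [DecidableEq A] [DecidableEq B] {N M : ℕ}
    (f : (Fin N → A) → (Fin M → B)) (g : (Fin M → B) → (Fin N → A)) (x : Fin N → A) :
    letterError (funScheme f g).total x = if g (f x) = x then 0 else 1 := by
  have h := letterError_add_diag (funScheme f g).total_isChannel x
  have hd : (funScheme f g).total x x = if g (f x) = x then 1 else 0 := by
    simp [CompressionScheme.total, funScheme, Matrix.mul_apply, funChannel, eq_comm]
  rw [hd] at h
  split_ifs at h ⊢ <;> linarith

lemma exists_errorProbability_le_blockProb {B : Type*} [Fintype B] [Nonempty B] [DecidableEq A]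
    {p : A → ℝ} (hp : p ∈ stdSimplex ℝ A) {N M : ℕ} (s : Finset (Fin N → A))
    (hs : s.card ≤ Fintype.card B ^ M) :
    ∃ S : CompressionScheme A B N M, errorProbability p S ≤ blockProb p N (s : Set _)ᶜ := by
  classical
  have hρ := tensorPow_mem_stdSimplex hp N
  obtain ⟨x₀⟩ : Nonempty (Fin N → A) := by
    by_contra hcon
    rw [not_nonempty_iff] at hcon
    have := hρ.2
    simp at this
  have hcard : Fintype.card s ≤ Fintype.card (Fin M → B) := by simpa using hs
  obtain ⟨j⟩ := Function.Embedding.nonempty_of_card_le hcard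
  obtain ⟨b₀⟩ : Nonempty (Fin M → B) := inferInstance
  -- The defaults `b₀` and `x₀` are harmless: every string outside `s` is already counted as an
  -- error.
  let f : (Fin N → A) → (Fin M → B) := fun x => if h : x ∈ s then j ⟨x, h⟩ else b₀
  let g : (Fin M → B) → (Fin N → A) := fun b => if h : ∃ y, j y = b then h.choose.1 else x₀
  have hgf : ∀ x ∈ s, g (f x) = x := by
    intro x hx
    have h : ∃ y, j y = f x := ⟨⟨x, hx⟩, by simp [f, hx]⟩
    have h1 : j h.choose = j ⟨x, hx⟩ := by rw [h.choose_spec]; simp [f, hx]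
    simp only [g, dif_pos h]
    rw [j.injective h1]
  refine ⟨funScheme f g, ?_⟩
  rw [errorProbability_eq]
  refine sum_le_sum fun x _ => ?_
  rw [letterError_funScheme]
  by_cases hx : x ∈ s
  · rw [if_pos (hgf x hx), mul_zero]
    exact Set.indicator_nonneg (fun x _ => hρ.1 x) x
  · rw [Set.indicator_of_mem (by simpa using hx)]
    split_ifs
    · simpa using hρ.1 x
    · simp

/-- Success has probability `∑ x, tensorPow p N x * S.total x x`. Strings of probability at most `c`
contribute at most `c` times the trace of `S.total`, which is at most the number of codewords since
entries of `S.enc` are at most one and columns of `S.dec` sum to one. -/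
lemma one_sub_errorProbability_le {B : Type*} [Fintype B] [DecidableEq A] {p : A → ℝ}
    (hp : p ∈ stdSimplex ℝ A) {N M : ℕ} (S : CompressionScheme A B N M) {c : ℝ} (hc : 0 ≤ c) :
    1 - errorProbability p S ≤
      blockProb p N {x | c < tensorPow p N x} + c * (Fintype.card B : ℝ) ^ M := by
  classical
  have hρ := tensorPow_mem_stdSimplex hp N
  have h1 : 1 - errorProbability p S = ∑ x, tensorPow p N x * S.total x x := by
    rw [errorProbability_eq, ← hρ.2, ← sum_sub_distrib]
    refine sum_congr rfl fun x _ => ?_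
    rw [eq_sub_of_add_eq (letterError_add_diag S.total_isChannel x)]
    ring
  have h2 : ∑ x, S.total x x ≤ (Fintype.card B : ℝ) ^ M := by
    calc ∑ x, S.total x x ≤ ∑ x, ∑ b : Fin M → B, S.dec x b := by
          refine sum_le_sum fun x _ => sum_le_sum fun (b : Fin M → B) _ => ?_
          refine mul_le_of_le_one_right ((S.dec_isChannel b).1 x) ?_
          rw [← (S.enc_isChannel x).2]
          exact single_le_sum (f := fun b => S.enc b x)
            (fun b _ => (S.enc_isChannel x).1 b) (mem_univ b)
      _ = ∑ b : Fin M → B, (1 : ℝ) := by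
          exact sum_comm.trans (sum_congr rfl fun b _ => (S.dec_isChannel b).2)
      _ = _ := by simp
  have h3 : ∀ x, 0 ≤ S.total x x := fun x => (S.total_isChannel x).1 x
  have h4 : ∀ x, S.total x x ≤ 1 := fun x => by
    rw [← (S.total_isChannel x).2]
    exact single_le_sum (f := fun y => S.total y x)
      (fun y _ => (S.total_isChannel x).1 y) (mem_univ x)
  rw [h1]
  calc ∑ x, tensorPow p N x * S.total x x
      ≤ ∑ x, ({x | c < tensorPow p N x}.indicator (tensorPow p N) x + c * S.total x x) := by
        refine sum_le_sum fun x _ => ?_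
        by_cases hx : c < tensorPow p N x
        · rw [Set.indicator_of_mem (by exact hx)]
          have := mul_le_of_le_one_right (hρ.1 x) (h4 x)
          have := mul_nonneg hc (h3 x)
          linarith
        · rw [Set.indicator_of_notMem (by exact hx), zero_add]
          exact mul_le_mul_of_nonneg_right (not_lt.1 hx) (h3 x)
    _ ≤ _ := by
        rw [sum_add_distrib, ← mul_sum]
        exact add_le_add le_rfl (mul_le_mul_of_nonneg_left h2 hc)

lemma card_le_of_le_tensorPow {p : A → ℝ} (hp : p ∈ stdSimplex ℝ A) {N : ℕ}
    (s : Finset (Fin N → A)) {c : ℝ} (hc : 0 < c) (h : ∀ x ∈ s, c ≤ tensorPow p N x) :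
    (s.card : ℝ) ≤ c⁻¹ := by
  have hρ := tensorPow_mem_stdSimplex hp N
  have h1 : s.card * c ≤ 1 := by
    rw [← hρ.2, ← nsmul_eq_mul]
    exact (card_nsmul_le_sum _ _ _ h).trans
      (sum_le_sum_of_subset_of_nonneg (subset_univ s) fun x _ _ => hρ.1 x)
  rwa [← one_div, le_div_iff₀ hc]

lemma mem_reliableSchemes_iff {B : Type*} [Fintype B] [DecidableEq A] {p : A → ℝ}
    (hp : p ∈ stdSimplex ℝ A) {N M : ℕ} {ε : ℝ} (S : CompressionScheme A B N M) :
    S ∈ reliableSchemes B p N M ε ↔ 2 * errorProbability p S < ε := by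
  rw [reliableSchemes, Set.mem_ofPred_eq, figureOfMerit_eq hp, EReal.coe_lt_coe_iff]

lemma shannonEntropy_nonneg {p : A → ℝ} (hp : p ∈ stdSimplex ℝ A) : 0 ≤ shannonEntropy p := by
  rw [shannonEntropy, ← sum_neg_distrib]
  refine sum_nonneg fun i _ => ?_
  have h1 : p i ≤ 1 := by
    rw [← hp.2]
    exact single_le_sum (fun j _ => hp.1 j) (mem_univ i)
  have := mul_nonneg (hp.1 i) (neg_nonneg.2 (Real.logb_nonpos one_lt_two (hp.1 i) h1))
  linarith

lemma eventually_compressionRatio_le [DecidableEq A] {p : A → ℝ} (hp : p ∈ stdSimplex ℝ A)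
    {ε : ℝ} (hε : 0 < ε) {r : ℝ} (hr : shannonEntropy p < r) :
    ∀ᶠ N in atTop, compressionRatio (Fin 2) p ε N ≤ (r : EReal) := by
  -- The gap between `r'` and `r` absorbs the rounding in `M = ⌈N * r'⌉₊` once `N * (r - r') ≥ 1`.
  obtain ⟨r', hr1, hr2⟩ := exists_between hr
  have hr0 : 0 < r' := (shannonEntropy_nonneg hp).trans_lt hr1
  have hlim := (tendsto_blockProb_atypically_small hp hr1).eventually_lt_const (half_pos hε)
  have hN : ∀ᶠ N : ℕ in atTop, 1 / (r - r') ≤ N :=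
    tendsto_natCast_atTop_atTop.eventually_ge_atTop _
  filter_upwards [hlim, hN, eventually_gt_atTop 0] with N h1 h2 h3
  have hN0 : (0 : ℝ) < N := by exact_mod_cast h3
  classical
  let s : Finset (Fin N → A) := univ.filter fun x => (2 : ℝ) ^ (-(N * r')) ≤ tensorPow p N x
  let M := ⌈N * r'⌉₊
  have hM : 0 < M := Nat.ceil_pos.2 (mul_pos hN0 hr0)
  have hcard : s.card ≤ Fintype.card (Fin 2) ^ M := by
    have h := card_le_of_le_tensorPow hp s (Real.rpow_pos_of_pos two_pos _)
      (fun x hx => (mem_filter.1 hx).2)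
    rw [← Real.rpow_neg two_pos.le, neg_neg] at h
    have h' : (s.card : ℝ) ≤ (2 : ℝ) ^ (M : ℝ) :=
      h.trans (Real.rpow_le_rpow_of_exponent_le one_le_two (Nat.le_ceil _))
    rw [Real.rpow_natCast] at h'
    rw [Fintype.card_fin]
    exact_mod_cast h'
  obtain ⟨S, hS⟩ := exists_errorProbability_le_blockProb hp s hcard
  have hcompl : ((s : Set (Fin N → A))ᶜ) = {x | tensorPow p N x < (2 : ℝ) ^ (-(N * r'))} := by
    ext x; simp [s]
  rw [hcompl] at hS
  have hmem : S ∈ reliableSchemes (Fin 2) p N M ε := by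
    rw [mem_reliableSchemes_iff hp]
    linarith
  refine (iInf₂_le M ⟨hM, ⟨S, hmem⟩⟩).trans (EReal.coe_le_coe_iff.2 ?_)
  rw [div_le_iff₀ hN0]
  have h4 := (Nat.ceil_lt_add_one (mul_pos hN0 hr0).le).le
  rw [div_le_iff₀ (sub_pos.2 hr2)] at h2
  have h5 : (M : ℝ) ≤ N * r' + 1 := h4
  nlinarith

lemma eventually_le_compressionRatio [DecidableEq A] {p : A → ℝ} (hp : p ∈ stdSimplex ℝ A)
    {ε : ℝ} (hε : ε < 2) {r : ℝ} (hr : r < shannonEntropy p) :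
    ∀ᶠ N in atTop, (r : EReal) ≤ compressionRatio (Fin 2) p ε N := by
  -- With threshold `c = 2 ^ (-(N * r'))` and fewer than `N * r` bits, the trace term is at most `2
  -- ^ (N * (r - r'))`, which vanishes.
  obtain ⟨r', hr1, hr2⟩ := exists_between hr
  have hlim1 := tendsto_blockProb_atypically_large hp hr2
  have hlim2 : Tendsto (fun N : ℕ => ((2 : ℝ) ^ (r - r')) ^ N) atTop (𝓝 0) :=
    tendsto_pow_atTop_nhds_zero_of_lt_one (Real.rpow_nonneg two_pos.le _)
      (Real.rpow_lt_one_of_one_lt_of_neg one_lt_two (by linarith))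
  have hlim := hlim1.add hlim2
  rw [add_zero] at hlim
  -- A reliable scheme succeeds with probability above `1 - ε / 2`, a positive bound exactly when `ε
  -- < 2`.
  filter_upwards [hlim.eventually_lt_const (show (0 : ℝ) < 1 - ε / 2 by linarith),
    eventually_gt_atTop 0] with N h1 h3
  have hN0 : (0 : ℝ) < N := by exact_mod_cast h3
  refine le_iInf₂ fun M hM => EReal.coe_le_coe_iff.2 ?_
  obtain ⟨-, S, hS⟩ := hM
  rw [mem_reliableSchemes_iff hp] at hS
  by_contra! hcon
  rw [div_lt_iff₀ hN0] at hcon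
  have h := one_sub_errorProbability_le hp S (Real.rpow_nonneg two_pos.le (-(N * r')))
  have h4 : (2 : ℝ) ^ (-(N * r')) * (Fintype.card (Fin 2) : ℝ) ^ M ≤ ((2 : ℝ) ^ (r - r')) ^ N := by
    rw [Fintype.card_fin, Nat.cast_ofNat, ← Real.rpow_natCast 2 M, ← Real.rpow_add two_pos,
      ← Real.rpow_natCast _ N, ← Real.rpow_mul two_pos.le]
    exact Real.rpow_le_rpow_of_exponent_le one_le_two (by linarith)
  linarith

lemma tendsto_compressionRatio [DecidableEq A] {p : A → ℝ} (hp : p ∈ stdSimplex ℝ A)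
    {ε : ℝ} (hε0 : 0 < ε) (hε : ε < 2) :
    Tendsto (compressionRatio (Fin 2) p ε) atTop (𝓝 ((shannonEntropy p : ℝ) : EReal)) := by
  refine tendsto_order.2 ⟨fun a ha => ?_, fun a ha => ?_⟩
  · obtain ⟨r, har, hr⟩ := EReal.lt_iff_exists_real_btwn.1 ha
    exact (eventually_le_compressionRatio hp hε (EReal.coe_lt_coe_iff.1 hr)).mono
      fun N h => har.trans_le h
  · obtain ⟨r, hr, har⟩ := EReal.lt_iff_exists_real_btwn.1 ha
    exact (eventually_compressionRatio_le hp hε0 (EReal.coe_lt_coe_iff.1 hr)).mono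
      fun N h => h.trans_lt har

lemma tendsto_asymptoticRatio [DecidableEq A] {p : A → ℝ} (hp : p ∈ stdSimplex ℝ A) :
    Tendsto (asymptoticRatio (Fin 2) p) (𝓝[>] (0 : ℝ)) (𝓝 ((shannonEntropy p : ℝ) : EReal)) := by
  refine tendsto_const_nhds.congr' ?_
  filter_upwards [Ioo_mem_nhdsGT (two_pos : (0 : ℝ) < 2)] with ε hε
  exact (tendsto_compressionRatio hp hε.1 hε.2).limsup_eq.symm

end SourceCoding

end ClassicalTheory

theorem mainTheorem2 {A : Type*} [Fintype A] [DecidableEq A] (p : A → ℝ)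
    (hp : p ∈ stdSimplex ℝ A) :
    -- The limit that defines the information content exists, and it is the Shannon entropy.
    (Tendsto (asymptoticRatio (Fin 2) p) (𝓝[>] (0 : ℝ)) (𝓝 (informationContent (Fin 2) p)) ∧
      informationContent (Fin 2) p = ((shannonEntropy p : ℝ) : EReal)) ∧
    -- On pure decompositions the figure of merit is twice the block error probability.
    (∀ (N M : ℕ) (S : CompressionScheme A (Fin 2) N M),
      (∀ (c : ℕ) (Ω : (Fin N → A) × Fin c → ℝ), IsDilation Ω (tensorPow p N) →
        ∀ (n : ℕ) (q : Fin n → ℝ) (Φ : Fin n → (Fin N → A) × Fin c → ℝ),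
          IsPureDecomposition q Φ Ω →
            ∑ i, q i * disturbance S.total (Φ i) = 2 * errorProbability p S) ∧
      pureFigureOfMerit p S = ((2 * errorProbability p S : ℝ) : EReal)) := by
  have hlim := tendsto_asymptoticRatio hp
  have heq : informationContent (Fin 2) p = ((shannonEntropy p : ℝ) : EReal) := hlim.limUnder_eq
  exact ⟨⟨by rwa [heq], heq⟩, fun N M S =>
    ⟨fun _ _ hΩ _ _ _ h => sum_mul_disturbance_eq S hΩ h, pureFigureOfMerit_eq hp S⟩⟩
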